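/- All logarithms are in base $2$. A randomized $\ell$-round probing algorithm on $n$ vertices, with unlimited computation time, is given access to an unknown graph $G$ on the vertex set $\{1,\dots,n\}$ as follows. In round $i=1,\dots,\ell$ it chooses, based on its own random bits (independent of $G$) and on the answers received in rounds $1,\dots,i-1$, a set $E_i$ of unordered pairs of distinct vertices, and then learns for every pair in $E_i$ whether it is an edge of $G$. After round $\ell$ it outputs a set of vertices, based on its random bits and on all the answers. It makes $\sum_{i=1}^{\ell}|E_i|$ probes. For real $\delta$ and an integer $\ell\ge 0$ let $\alpha_\star(\delta,\ell)$ be the supremum of the real numbers $\alpha$ for which there is a family $(A_n)_{n}$, where $A_n$ is a randomized $\ell$-round probing algorithm on $n$ vertices that always makes at most $n^{\delta}$ probes, such that for infinitely many $n$ the following holds: on an input $G$ drawn from $G_{n,1/2}$ (each pair of vertices is an edge independently with probability $1/2$), $A_n$ outputs with probability at least $1/2$, over $G$ and its random bits, a set of vertices that is a clique of $G$ and has size at least $\alpha\log n$. **Theorem.** For every real $\delta<2$ and every constant integer $\ell\ge 0$, $$\alpha_\star(\delta,\ell)<2 .$$ In particular there is $\alpha<2$, depending only on $\delta$ and $\ell$,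 such that for all sufficiently large $n$ no randomized $\ell$-round probing algorithm on $n$ vertices that always makes at most $n^{\delta}$ probes outputs a clique of $G\sim G_{n,1/2}$ of size at least $\alpha\log n$ with probability at least $1/2$. -/

import Mathlib

open MeasureTheory Filter

/-- The potential edges (unordered pairs of distinct vertices) of an `n` vertex graph. -/
abbrev VertexPair (n : ℕ) : Type := {e : Sym2 (Fin n) // ¬ e.IsDiag}

/-- One entry per completed round, in chronological order: the set of pairs probed in that round,
and the subset of those pairs that turned out to be edges. -/
abbrev Transcript (n : ℕ) : Type := List (Finset (VertexPair n) × Finset (VertexPair n))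

/-- A deterministic algorithm probing an `n` vertex graph in rounds, with unbounded computation:
given the transcript of the previous rounds it chooses the set of pairs that are probed (in
parallel) in the next round, and given the final transcript it chooses the set of vertices
that it outputs. -/
structure ProbeAlgorithm (n : ℕ) where
  query : Transcript n → Finset (VertexPair n)
  output : Transcript n → Finset (Fin n)

namespace ProbeAlgorithm

open Classical in
/-- The transcript after the first `ℓ` rounds on the input graph `G`. -/
noncomputable def transcript {n : ℕ} (A : ProbeAlgorithm n) (G : SimpleGraph (Fin n)) :
    ℕ → Transcript n
  | 0 => []
  | ℓ + 1 =>
    A.transcript G ℓ ++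
      [(A.query (A.transcript G ℓ),
        (A.query (A.transcript G ℓ)).filter fun e : VertexPair n => e.1 ∈ G.edgeSet)]

/-- The total number `|E₁| + ⋯ + |E_ℓ|` of probes made in the first `ℓ` rounds on input `G`. -/
noncomputable def probeCount {n : ℕ} (A : ProbeAlgorithm n) (ℓ : ℕ)
    (G : SimpleGraph (Fin n)) : ℕ :=
  ∑ i ∈ Finset.range ℓ, (A.query (A.transcript G i)).card

/-- On input `G`, after `ℓ` rounds, the algorithm outputs a clique of `G` of size at least `s`. -/
def FindsClique {n : ℕ} (A : ProbeAlgorithm n) (ℓ : ℕ) (s : ℝ) (G : SimpleGraph (Fin n)) : Prop :=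
  G.IsClique (A.output (A.transcript G ℓ) : Set (Fin n)) ∧
    s ≤ ((A.output (A.transcript G ℓ)).card : ℝ)

end ProbeAlgorithm

/-- The law `G_{n,1/2}`. -/
noncomputable def randomGraphHalf (n : ℕ) : Measure (SimpleGraph (Fin n)) :=
  SimpleGraph.binomialRandom (Fin n) ⟨1 / 2, by norm_num, by norm_num⟩

/-- A randomized algorithm: a random choice of a deterministic algorithm, made independently of
the input graph. (Runs of `ℓ` rounds on `n` vertex graphs exhibit only finitely many different
behaviours, so discrete distributions lose no generality.) -/
abbrev RandomizedProbeAlgorithm (n : ℕ) : Type := PMF (ProbeAlgorithm n)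

namespace RandomizedProbeAlgorithm

/-- The algorithm never makes more than `q` probes in `ℓ` rounds, whatever its random choices and
the input graph. -/
def ProbesAtMost {n : ℕ} (R : RandomizedProbeAlgorithm n) (ℓ : ℕ) (q : ℝ) : Prop :=
  ∀ A ∈ R.support, ∀ G : SimpleGraph (Fin n), (A.probeCount ℓ G : ℝ) ≤ q

/-- The probability, over an input drawn from `G_{n,1/2}` and the independent random choices of the
algorithm, that a clique of size at least `s` is output after `ℓ` rounds. -/
noncomputable def successProb {n : ℕ} (R : RandomizedProbeAlgorithm n) (ℓ : ℕ) (s : ℝ) : ENNReal :=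
  ∑' A : ProbeAlgorithm n, R A * randomGraphHalf n {G | A.FindsClique ℓ s G}

end RandomizedProbeAlgorithm

/-- There is an algorithm (one for each number `n` of vertices) that makes at most `n ^ δ` probes,
in `ℓ` rounds, and for infinitely many `n` outputs a clique of size at least `α log₂ n` with
probability at least `1/2`. Asking for success only for infinitely many `n`, rather than for all
sufficiently large `n`, gives the larger supremum `alphaStar` of the two. -/
def Achievable (δ : ℝ) (ℓ : ℕ) (α : ℝ) : Prop :=
  ∃ R : (n : ℕ) → RandomizedProbeAlgorithm n,
    (∀ n : ℕ, (R n).ProbesAtMost ℓ ((n : ℝ) ^ δ)) ∧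
    ∃ᶠ n : ℕ in atTop, 1 / 2 ≤ (R n).successProb ℓ (α * Real.logb 2 n)

/-- The supremum of the achievable `α`, in the extended reals so that it always exists. -/
noncomputable def alphaStar (δ : ℝ) (ℓ : ℕ) : EReal :=
  ⨆ α ∈ {α : ℝ | Achievable δ ℓ α}, (α : EReal)

/-!
Fix a deterministic algorithm, and let `U` be a set of `k ≈ α log₂ n` vertices, with `α` close
to `2`. Given the transcript of some rounds, `U` is a clique with probability at most `2 ^ (-r)`,
where `r` is the number of its pairs that are still unprobed. Hence (`measureReal_exists_isClique_le`)
it is unlikely that any member of a family determined by the transcript is a clique, provided that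
the family is small compared with `2 ^ r`. This is the only probabilistic input.

It is applied once for each round, and once at the end. Consider the sets `U` of which at most
`σ k ^ 2` pairs were probed before a round and at least `η k ^ 2` pairs are probed in it. Such a `U`
contains about `η k / 2` disjoint pairs among the at most `n ^ δ` probed ones. So there are at most
`n ^ (k - (2 - δ) η k / 2)` such sets (`card_filter_card_pairsIn_inter_le`) instead of about `n ^ k`,
while each of them is still a clique with probability at most about `2 ^ (-(k ^ 2 / 2 - σ k ^ 2))`.
For `α` close to `2`, the saving `(2 - δ) η / 4` in the exponent exceeds the loss `σ` if
`η = 8 σ / (2 - δ)`, and then with high probability no such `U` is a clique.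

Now let `σ` grow from round to round by the factor `1 + 8 / (2 - δ)`, starting from `σ₀` so small
that it is still at most `1 / 4` after `ℓ` rounds. If the output clique occurs in none of the
families above, then inductively at most `σ k ^ 2` of its pairs are probed up to each round. In the
end nearly half of its pairs are unprobed, and the single set that is output is unlikely to be a
clique. All error terms are at most `2 ^ (-(σ₀ / 2) k ^ 2 + 3 k)`, which gives the bound
`α = 2 / (1 + σ₀)`. Randomized algorithms are averages of deterministic ones.
-/

/-! ### The uniform random graph -/

instance isProbabilityMeasure_randomGraphHalf (n : ℕ) :
    IsProbabilityMeasure (randomGraphHalf n) := by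
  unfold randomGraphHalf; infer_instance

lemma randomGraphHalf_real_singleton {n : ℕ} (G : SimpleGraph (Fin n)) :
    (randomGraphHalf n).real {G} = (1 / 2 : ℝ) ^ n.choose 2 := by
  classical
  have hle : G.edgeSet.ncard ≤ n.choose 2 := by
    have := G.card_edgeFinset_le_card_choose_two
    rwa [Fintype.card_fin, ← SimpleGraph.coe_edgeFinset, Set.ncard_coe_finset] at *
  have hσ : unitInterval.toNNReal (unitInterval.symm ⟨1 / 2, by norm_num, by norm_num⟩)
      = unitInterval.toNNReal ⟨1 / 2, by norm_num, by norm_num⟩ := by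
    ext; simp; norm_num
  rw [randomGraphHalf, measureReal_def, SimpleGraph.binomialRandom_singleton, hσ, ← pow_add]
  simp only [Nat.card_eq_fintype_card, Fintype.card_fin, Nat.add_sub_cancel' hle]
  simp

instance measurableSingletonClass_simpleGraph_fin (n : ℕ) :
    MeasurableSingletonClass (SimpleGraph (Fin n)) where
  measurableSet_singleton G := by
    rw [← SimpleGraph.measurableEmbedding_edgeSet.measurableSet_image, Set.image_singleton]
    exact measurableSet_singleton _

open Classical in
lemma randomGraphHalf_real_eq_card {n : ℕ} (S : Set (SimpleGraph (Fin n))) :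
    (randomGraphHalf n).real S
      = ((Finset.univ.filter (· ∈ S)).card : ℝ) * (1 / 2 : ℝ) ^ n.choose 2 := by
  have h : S = ((Finset.univ.filter (· ∈ S) : Finset (SimpleGraph (Fin n))) : Set _) := by
    ext; simp
  conv_lhs => rw [h]
  rw [← sum_measureReal_singleton]
  simp [randomGraphHalf_real_singleton]

/-! ### Probed pairs and independence of the rest of the graph -/

open Classical in
/-- The pairs probed in some round of the transcript. -/
noncomputable def Transcript.probed {n : ℕ} (t : Transcript n) : Finset (VertexPair n) :=
  Finset.univ.filter fun e => ∃ r ∈ t, e ∈ r.1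

/-- The pairs of distinct vertices with both endpoints in `U`. -/
def pairsIn {n : ℕ} (U : Finset (Fin n)) : Finset (VertexPair n) :=
  Finset.univ.filter fun e => ∀ v ∈ e.1, v ∈ U

lemma mem_pairsIn {n : ℕ} {U : Finset (Fin n)} {e : VertexPair n} :
    e ∈ pairsIn U ↔ ∀ v ∈ e.1, v ∈ U := by
  simp [pairsIn]

lemma card_pairsIn {n : ℕ} (U : Finset (Fin n)) : (pairsIn U).card = U.card.choose 2 := by
  rw [← Sym2.card_image_offDiag, ← Finset.card_map (Function.Embedding.subtype _)]
  congr 1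
  ext e
  induction e with | _ x y
  simp only [Finset.mem_map, mem_pairsIn, Function.Embedding.subtype_apply, Subtype.exists,
    Finset.mem_image, Finset.mem_offDiag, Prod.exists]
  constructor
  · rintro ⟨a, ha, hU, rfl⟩
    exact ⟨x, y, ⟨hU x (by simp), hU y (by simp), by simpa using ha⟩, rfl⟩
  · rintro ⟨a, b, ⟨ha, hb, hab⟩, he⟩
    rw [← he]
    exact ⟨s(a, b), by simpa using hab, by simp [ha, hb], rfl⟩

lemma SimpleGraph.IsClique.mem_edgeSet_of_mem_pairsIn {n : ℕ} {G : SimpleGraph (Fin n)}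
    {U : Finset (Fin n)} (h : G.IsClique (U : Set (Fin n))) {e : VertexPair n}
    (he : e ∈ pairsIn U) : e.1 ∈ G.edgeSet := by
  obtain ⟨e, hd⟩ := e
  induction e with | _ x y
  rw [mem_pairsIn] at he
  exact h (he x (by simp)) (he y (by simp)) (by simpa using hd)

lemma Transcript.probed_append_singleton {n : ℕ} (t : Transcript n)
    (r : Finset (VertexPair n) × Finset (VertexPair n)) :
    Transcript.probed (t ++ [r]) = t.probed ∪ r.1 := by
  ext e
  simp only [Transcript.probed, Finset.mem_filter, Finset.mem_univ, true_and, List.mem_append,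
    List.mem_singleton, Finset.mem_union]
  grind

namespace ProbeAlgorithm

variable {n : ℕ} (A : ProbeAlgorithm n)

lemma probed_transcript_succ (G : SimpleGraph (Fin n)) (i : ℕ) :
    (A.transcript G (i + 1)).probed
      = (A.transcript G i).probed ∪ A.query (A.transcript G i) := by
  rw [transcript, Transcript.probed_append_singleton]

/-- The transcript depends only on the probed part of the graph. -/
lemma transcript_congr {G H : SimpleGraph (Fin n)} {i : ℕ}
    (h : ∀ e ∈ (A.transcript G i).probed, (e.1 ∈ G.edgeSet ↔ e.1 ∈ H.edgeSet)) :
    A.transcript H i = A.transcript G i := by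
  induction i with
  | zero => rfl
  | succ i ih =>
    rw [probed_transcript_succ] at h
    have hi := ih fun e he => h e (Finset.mem_union_left _ he)
    rw [transcript, transcript, hi]
    congr 3
    ext e
    simp only [Finset.mem_filter]
    exact and_congr_right fun he => (h e (Finset.mem_union_right _ he)).symm

open Classical in
/-- Given the transcript, each pair not yet probed is an edge with probability `1/2`,
independently. The proof is a double count: deleting an arbitrary subset of `S` from a graph that
contains `S` does not change the transcript, and graph and subset can be recovered. -/
lemma measureReal_transcript_eq_and_subset_le (i : ℕ) (t : Transcript n)
    (S : Finset (VertexPair n)) (hS : Disjoint S t.probed) :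
    (randomGraphHalf n).real {G | A.transcript G i = t ∧ ∀ e ∈ S, e.1 ∈ G.edgeSet}
      ≤ (1 / 2 : ℝ) ^ S.card * (randomGraphHalf n).real {G | A.transcript G i = t} := by
  simp only [randomGraphHalf_real_eq_card, ← mul_assoc]
  refine mul_le_mul_of_nonneg_right ?_ (by positivity)
  rw [one_div, inv_pow, ← div_eq_inv_mul, le_div_iff₀ (by positivity)]
  norm_cast
  rw [← Finset.card_powerset, ← Finset.card_product]
  refine Finset.card_le_card_of_injOn
    (fun p => p.1.deleteEdges ((p.2.image Subtype.val : Finset (Sym2 (Fin n))) : Set _)) ?_ ?_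
  · rintro ⟨G, X⟩ hp
    simp only [Finset.coe_product, Set.mem_prod, Finset.mem_coe, Finset.mem_filter,
      Finset.mem_univ, true_and, Set.mem_ofPred_eq, Finset.mem_powerset] at hp ⊢
    obtain ⟨⟨rfl, hG⟩, hX⟩ := hp
    refine A.transcript_congr fun e he => ?_
    have : e ∉ X := fun h => Finset.disjoint_left.1 hS (hX h) he
    simp only [SimpleGraph.edgeSet_deleteEdges, Set.mem_sdiff, Finset.coe_image, Set.mem_image,
      Finset.mem_coe]
    refine ⟨fun h => ⟨h, ?_⟩, fun h => h.1⟩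
    rintro ⟨e', he', h'⟩
    exact this (Subtype.ext h' ▸ he')
  · rintro ⟨G, X⟩ hp ⟨G', X'⟩ hp' heq
    simp only [Finset.coe_product, Set.mem_prod, Finset.mem_coe, Finset.mem_filter,
      Finset.mem_univ, true_and, Set.mem_ofPred_eq, Finset.mem_powerset] at hp hp'
    obtain ⟨⟨-, hG⟩, hX⟩ := hp
    obtain ⟨⟨-, hG'⟩, hX'⟩ := hp'
    have key : ∀ e : VertexPair n, (e.1 ∈ G.edgeSet ∧ e ∉ X) ↔ (e.1 ∈ G'.edgeSet ∧ e ∉ X') := by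
      intro e
      have := congrArg (fun H : SimpleGraph (Fin n) => e.1 ∈ H.edgeSet) heq
      simpa [SimpleGraph.edgeSet_deleteEdges, e.2] using this
    have hXX : X = X' := by
      ext e
      have := key e
      have h1 := hG e
      have h2 := hG' e
      have h3 := @hX e
      have h4 := @hX' e
      tauto
    subst hXX
    refine Prod.ext ?_ rfl
    refine SimpleGraph.edgeSet_injective ?_
    ext e
    by_cases hd : e.IsDiag
    · exact iff_of_false (fun h => G.not_isDiag_of_mem_edgeSet h hd)
        (fun h => G'.not_isDiag_of_mem_edgeSet h hd)
    · have := key ⟨e, hd⟩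
      have h1 := hG ⟨e, hd⟩
      have h2 := hG' ⟨e, hd⟩
      have h3 := @hX ⟨e, hd⟩
      simp only at this h1 h2
      tauto

open Classical in
/-- First moment bound for cliques, conditional on the transcript: if the transcript singles out
at most `M` candidate sets, each with at least `r` unprobed pairs, then some candidate is a clique
with probability at most `M * 2 ^ (-r)`. -/
lemma measureReal_exists_isClique_le (i : ℕ) (F : Transcript n → Finset (Finset (Fin n)))
    (M r : ℝ) (hM : ∀ G, ((F (A.transcript G i)).card : ℝ) ≤ M)
    (hr : ∀ t, ∀ U ∈ F t, r ≤ ((pairsIn U \ t.probed).card : ℝ)) :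
    (randomGraphHalf n).real
        {G | ∃ U ∈ F (A.transcript G i), G.IsClique (U : Set (Fin n))} ≤ M * 2 ^ (-r) := by
  set μ := randomGraphHalf n
  set T : Finset (Transcript n) := Finset.univ.image fun G => A.transcript G i
  have hsub : {G | ∃ U ∈ F (A.transcript G i), G.IsClique (U : Set (Fin n))} ⊆
      ⋃ t ∈ T, ⋃ U ∈ F t,
        {G | A.transcript G i = t ∧ ∀ e ∈ pairsIn U \ t.probed, e.1 ∈ G.edgeSet} := by
    rintro G ⟨U, hU, hG⟩
    simp only [Set.mem_iUnion]
    exact ⟨A.transcript G i, Finset.mem_image_of_mem _ (Finset.mem_univ _), U, hU, rfl,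
      fun e he => hG.mem_edgeSet_of_mem_pairsIn (Finset.mem_sdiff.1 he).1⟩
  calc _ ≤ _ := measureReal_mono hsub (measure_ne_top _ _)
    _ ≤ ∑ t ∈ T, μ.real (⋃ U ∈ F t,
        {G | A.transcript G i = t ∧ ∀ e ∈ pairsIn U \ t.probed, e.1 ∈ G.edgeSet}) :=
      measureReal_biUnion_finset_le _ _
    _ ≤ ∑ t ∈ T, M * 2 ^ (-r) * μ.real {G | A.transcript G i = t} := by
      refine Finset.sum_le_sum fun t ht => ?_
      obtain ⟨G, -, rfl⟩ := Finset.mem_image.1 ht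
      refine (measureReal_biUnion_finset_le _ _).trans ?_
      refine (Finset.sum_le_card_nsmul _ _
        ((2 : ℝ) ^ (-r) * μ.real {H | A.transcript H i = A.transcript G i}) ?_).trans ?_
      · intro U hU
        refine (A.measureReal_transcript_eq_and_subset_le i _ _ Finset.sdiff_disjoint).trans ?_
        refine mul_le_mul_of_nonneg_right ?_ measureReal_nonneg
        rw [one_div, inv_pow, ← Real.rpow_natCast, ← Real.rpow_neg two_pos.le]
        exact Real.rpow_le_rpow_of_exponent_le one_le_two (neg_le_neg (hr _ U hU))
      · rw [nsmul_eq_mul, mul_assoc]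
        exact mul_le_mul_of_nonneg_right (hM G) (by positivity)
    _ = M * 2 ^ (-r) * μ.real (⋃ t ∈ T, {G | A.transcript G i = t}) := by
      rw [← Finset.mul_sum, measureReal_biUnion_finset]
      · intro t _ t' _ h
        exact Set.disjoint_left.2 fun G hG hG' => h (hG.symm.trans hG')
      · exact fun t _ => (Set.toFinite _).measurableSet
    _ ≤ M * 2 ^ (-r) := by
      have hM0 : 0 ≤ M := (Nat.cast_nonneg _).trans (hM ⊥)
      exact mul_le_of_le_one_right (by positivity) measureReal_le_one

end ProbeAlgorithm

/-! ### Counting sets that span many pairs of a sparse graph -/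

/-- Removing the endpoints of a pair from `U` destroys at most `2 |U|` of the pairs in `U`. -/
lemma card_pairsIn_inter_le {n : ℕ} (E : Finset (VertexPair n)) (U : Finset (Fin n)) (x y : Fin n) :
    (pairsIn U ∩ E).card ≤ (pairsIn (U \ {x, y}) ∩ E).card + 2 * U.card := by
  classical
  have hsub : (pairsIn U ∩ E).map (Function.Embedding.subtype _) ⊆
      (pairsIn (U \ {x, y}) ∩ E).map (Function.Embedding.subtype _) ∪
        (U.image (fun z => s(x, z)) ∪ U.image (fun z => s(y, z))) := by
    intro e he
    simp only [Finset.mem_map, Finset.mem_inter, Function.Embedding.subtype_apply] at he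
    obtain ⟨f, ⟨hf, hE⟩, rfl⟩ := he
    by_cases hx : x ∈ f.1
    · obtain ⟨z, hz⟩ := hx
      refine Finset.mem_union_right _ (Finset.mem_union_left _ (Finset.mem_image.2 ⟨z, ?_, hz.symm⟩))
      exact mem_pairsIn.1 hf z (by rw [hz]; simp)
    by_cases hy : y ∈ f.1
    · obtain ⟨z, hz⟩ := hy
      refine Finset.mem_union_right _ (Finset.mem_union_right _ (Finset.mem_image.2 ⟨z, ?_, hz.symm⟩))
      exact mem_pairsIn.1 hf z (by rw [hz]; simp)
    · refine Finset.mem_union_left _ (Finset.mem_map.2 ⟨f, Finset.mem_inter.2 ⟨?_, hE⟩, rfl⟩)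
      rw [mem_pairsIn]
      intro v hv
      have := mem_pairsIn.1 hf v hv
      simp only [Finset.mem_sdiff, Finset.mem_insert, Finset.mem_singleton]
      refine ⟨this, ?_⟩
      rintro (rfl | rfl)
      exacts [hx hv, hy hv]
  have h := Finset.card_le_card hsub
  rw [Finset.card_map] at h
  have h1 := Finset.card_union_le ((pairsIn (U \ {x, y}) ∩ E).map (Function.Embedding.subtype _))
        (U.image (fun z => s(x, z)) ∪ U.image (fun z => s(y, z)))
  have h2 := Finset.card_union_le (U.image (fun z => s(x, z))) (U.image (fun z => s(y, z)))
  have h3 := Finset.card_image_le (s := U) (f := fun z => s(x, z))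
  have h4 := Finset.card_image_le (s := U) (f := fun z => s(y, z))
  rw [Finset.card_map] at h1
  omega

/-- A set of `j + 2ν` vertices that spans enough pairs of `E` contains `ν` disjoint pairs of `E`,
found greedily; hence it is determined by these and by the remaining `j` vertices. -/
lemma card_filter_card_pairsIn_inter_le {n : ℕ} (E : Finset (VertexPair n)) (j ν : ℕ) :
    ((Finset.univ : Finset (Finset (Fin n))).filter fun U =>
        U.card = j + 2 * ν ∧ 2 * (j + 2 * ν) * ν ≤ (pairsIn U ∩ E).card).card
      ≤ E.card ^ ν * n ^ j := by
  classical
  induction ν with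
  | zero =>
    have : ((Finset.univ : Finset (Finset (Fin n))).filter fun U =>
        U.card = j + 2 * 0 ∧ 2 * (j + 2 * 0) * 0 ≤ (pairsIn U ∩ E).card)
        = Finset.univ.powersetCard j := by
      ext U; simp
    rw [this, Finset.card_powersetCard, Finset.card_univ, Fintype.card_fin, pow_zero, one_mul]
    exact Nat.choose_le_pow n j
  | succ ν ih =>
    rw [pow_succ', mul_assoc E.card]
    refine le_trans ?_ (Nat.mul_le_mul_left E.card ih)
    rw [← Finset.card_product]
    refine le_trans (Finset.card_le_card ?_) (Finset.card_image_le
      (f := fun p : VertexPair n × Finset (Fin n) => p.1.1.toFinset ∪ p.2))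
    intro U hU
    simp only [Finset.mem_filter, Finset.mem_univ, true_and] at hU
    obtain ⟨hc, hU⟩ := hU
    have hpos : 0 < (pairsIn U ∩ E).card := lt_of_lt_of_le (by positivity) hU
    obtain ⟨⟨e, hd⟩, he⟩ := Finset.card_pos.1 hpos
    induction e with | _ x y
    rw [Finset.mem_inter, mem_pairsIn] at he
    obtain ⟨hxy, hE⟩ := he
    have hx : x ∈ U := hxy x (by simp)
    have hy : y ∈ U := hxy y (by simp)
    have hne : x ≠ y := by simpa using hd
    have hs : ({x, y} : Finset (Fin n)) ⊆ U := by
      intro z hz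
      simp only [Finset.mem_insert, Finset.mem_singleton] at hz
      rcases hz with rfl | rfl <;> assumption
    refine Finset.mem_image.2 ⟨(⟨s(x, y), hd⟩, U \ {x, y}), ?_, ?_⟩
    · rw [Finset.mem_product]
      refine ⟨hE, ?_⟩
      simp only [Finset.mem_filter, Finset.mem_univ, true_and]
      have h1 : (U \ {x, y}).card = j + 2 * ν := by
        rw [Finset.card_sdiff_of_subset hs, Finset.card_pair hne]; omega
      refine ⟨h1, ?_⟩
      have h2 := card_pairsIn_inter_le E U x y
      rw [hc] at h2
      nlinarith
    · have : (s(x, y) : Sym2 (Fin n)).toFinset = {x, y} := by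
        ext; simp [Sym2.mem_toFinset]
      simp only [this]
      exact Finset.union_sdiff_of_subset hs

/-! ### Deterministic algorithms -/

/-- The exponent in the first moment bound for one round. Here `L` is the logarithm of the number
of vertices, `ν` the number of disjoint pairs forced by `(8 / γ) * σ * k ^ 2` probed pairs, and
`r` the number of pairs that are left to chance. -/
lemma round_exponent_le {γ σ₀ σ k ν L r : ℝ} (hγ : 0 < γ) (hγ2 : γ ≤ 2) (hσ₀ : 0 < σ₀)
    (hσ₀1 : σ₀ ≤ 1 / 4) (hσ : σ₀ ≤ σ) (hk : 0 ≤ k) (hν : 4 / γ * σ * k - 1 ≤ ν)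
    (hνk : 2 * ν ≤ k) (hL : L ≤ k * (1 + σ₀) / 2)
    (hr : k * (k - 1) / 2 - σ * k ^ 2 ≤ r) :
    L * (k - γ * ν) - r ≤ -(σ₀ / 2) * k ^ 2 + 3 * k := by
  have h1 : 0 ≤ k - γ * ν := by nlinarith
  have h2 : L * (k - γ * ν) ≤ k * (1 + σ₀) / 2 * (k - γ * ν) :=
    mul_le_mul_of_nonneg_right hL h1
  have h3 : 4 * σ * k - γ ≤ γ * ν := by
    have := mul_le_mul_of_nonneg_left hν hγ.le
    have e : γ * (4 / γ * σ * k - 1) = 4 * σ * k - γ := by field_simp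
    rwa [e] at this
  have h4 : k * (1 + σ₀) / 2 * (k - γ * ν) ≤ k * (1 + σ₀) / 2 * (k - (4 * σ * k - γ)) :=
    mul_le_mul_of_nonneg_left (by linarith) (by positivity)
  have h5 : k * (1 + σ₀) / 2 * γ ≤ 2 * k := by
    have : (1 + σ₀) * γ ≤ 4 := by nlinarith
    nlinarith
  have h6 : 0 ≤ σ₀ * σ * k ^ 2 := by
    have : 0 ≤ σ := hσ₀.le.trans hσ
    positivity
  have h7 : 0 ≤ (σ - σ₀) * k ^ 2 := mul_nonneg (by linarith) (by positivity)
  nlinarith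

namespace ProbeAlgorithm

variable {n : ℕ} (A : ProbeAlgorithm n)

open Classical in
/-- The event that a clique of size `k` appears of whose pairs at most `σ k ^ 2` were probed in the
first `i` rounds, and many are probed in the next round. -/
lemma measureReal_exists_isClique_round_le (i : ℕ) {δ σ₀ σ : ℝ} {k : ℕ} (hn : 0 < n)
    (hδ0 : 0 ≤ δ) (hδ2 : δ < 2) (hσ₀ : 0 < σ₀) (hσ₀1 : σ₀ ≤ 1 / 4) (hσ : σ₀ ≤ σ)
    (hσ1 : 8 / (2 - δ) * σ ≤ 1) (hk : Real.logb 2 n ≤ k * (1 + σ₀) / 2)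
    (hA : ∀ G, ((A.query (A.transcript G i)).card : ℝ) ≤ (n : ℝ) ^ δ) :
    (randomGraphHalf n).real {G | ∃ U : Finset (Fin n), U.card = k ∧
        ((pairsIn U ∩ (A.transcript G i).probed).card : ℝ) ≤ σ * k ^ 2 ∧
        8 / (2 - δ) * σ * k ^ 2 ≤ ((pairsIn U ∩ A.query (A.transcript G i)).card : ℝ) ∧
        G.IsClique (U : Set (Fin n))}
      ≤ 2 ^ (-(σ₀ / 2) * k ^ 2 + 3 * k : ℝ) := by
  have hγ : 0 < 2 - δ := by linarith
  have hσ0 : 0 < σ := hσ₀.trans_le hσ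
  -- the largest `ν` for which `8 / (2 - δ) * σ * k ^ 2` pairs suffice to find `ν` disjoint ones
  set ν : ℕ := ⌊4 / (2 - δ) * σ * k⌋₊
  have hν : (ν : ℝ) ≤ 4 / (2 - δ) * σ * k := Nat.floor_le (by positivity)
  have hν' : 4 / (2 - δ) * σ * k - 1 ≤ ν := by
    have := Nat.lt_floor_add_one (4 / (2 - δ) * σ * k)
    linarith
  have e8 : 8 / (2 - δ) * σ = 2 * (4 / (2 - δ) * σ) := by ring
  have hνk : 2 * (ν : ℝ) ≤ k := by
    have : 8 / (2 - δ) * σ * k ≤ 1 * k := mul_le_mul_of_nonneg_right hσ1 (Nat.cast_nonneg _)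
    rw [e8] at this
    linarith
  have hνk' : 2 * ν ≤ k := by exact_mod_cast hνk
  obtain ⟨j, hj⟩ := Nat.exists_eq_add_of_le' hνk'
  let F : Transcript n → Finset (Finset (Fin n)) := fun t => Finset.univ.filter fun U =>
    (U.card = k ∧ 2 * k * ν ≤ (pairsIn U ∩ A.query t).card) ∧
      ((pairsIn U ∩ t.probed).card : ℝ) ≤ σ * k ^ 2
  have hM : ∀ G, ((F (A.transcript G i)).card : ℝ) ≤ ((n : ℝ) ^ δ) ^ ν * (n : ℝ) ^ j := by
    intro G
    have h1 : (F (A.transcript G i)).card ≤ (A.query (A.transcript G i)).card ^ ν * n ^ j := by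
      refine le_trans (Finset.card_le_card ?_)
        (card_filter_card_pairsIn_inter_le (A.query (A.transcript G i)) j ν)
      intro U hU
      have h := (Finset.mem_filter.1 hU).2.1
      refine Finset.mem_filter.2 ⟨Finset.mem_univ _, ?_⟩
      rwa [← hj]
    refine le_trans (Nat.cast_le.2 h1) ?_
    push_cast
    exact mul_le_mul_of_nonneg_right (pow_le_pow_left₀ (Nat.cast_nonneg _) (hA G) _)
      (pow_nonneg (Nat.cast_nonneg _) _)
  have hr : ∀ t, ∀ U ∈ F t,
      (k * (k - 1) / 2 - σ * k ^ 2 : ℝ) ≤ ((pairsIn U \ t.probed).card : ℝ) := by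
    intro t U hU
    simp only [F, Finset.mem_filter, Finset.mem_univ, true_and] at hU
    have h1 := Finset.card_sdiff_add_card_inter (pairsIn U) t.probed
    rw [card_pairsIn, hU.1.1] at h1
    have h2 : ((pairsIn U \ t.probed).card : ℝ) + ((pairsIn U ∩ t.probed).card : ℝ)
        = k * (k - 1) / 2 := by
      rw [← Nat.cast_choose_two, ← h1]; push_cast; ring
    linarith [hU.2]
  refine le_trans (measureReal_mono ?_ (measure_ne_top _ _))
    ((A.measureReal_exists_isClique_le i F _ _ hM hr).trans ?_)
  · rintro G ⟨U, hUk, h1, h2, hG⟩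
    refine ⟨U, ?_, hG⟩
    simp only [F, Finset.mem_filter, Finset.mem_univ, true_and]
    refine ⟨⟨hUk, ?_⟩, h1⟩
    have : (2 * k * ν : ℝ) ≤ ((pairsIn U ∩ A.query (A.transcript G i)).card : ℝ) := by
      refine le_trans ?_ h2
      rw [e8]
      have := mul_le_mul_of_nonneg_left hν (Nat.cast_nonneg (α := ℝ) k)
      linarith
    exact_mod_cast this
  · have hn' : (0 : ℝ) < n := Nat.cast_pos.2 hn
    have hjR : (j : ℝ) = k - 2 * ν := by
      rw [hj]; push_cast; ring
    have h2n : (n : ℝ) = 2 ^ Real.logb 2 n :=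
      (Real.rpow_logb two_pos (by norm_num) hn').symm
    have : ((n : ℝ) ^ δ) ^ ν * (n : ℝ) ^ j = 2 ^ (Real.logb 2 n * (k - (2 - δ) * ν)) := by
      rw [← Real.rpow_natCast, ← Real.rpow_natCast, ← Real.rpow_mul hn'.le,
        ← Real.rpow_add hn', Real.rpow_mul two_pos.le, ← h2n, hjR]
      congr 1
      ring
    rw [this, ← Real.rpow_add two_pos]
    refine Real.rpow_le_rpow_of_exponent_le one_le_two ?_
    rw [← sub_eq_add_neg]
    exact round_exponent_le hγ (by linarith) hσ₀ hσ₀1 hσ (Nat.cast_nonneg _) hν' hνk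
      hk le_rfl

/-- A set determined by the transcript, many of whose pairs were never probed, is unlikely to be
a clique. -/
lemma measureReal_isClique_of_few_probed_le (i : ℕ) (O : Transcript n → Finset (Fin n))
    {σ₀ σ : ℝ} {k : ℕ} (hσ₀1 : σ₀ ≤ 1 / 4) (hσ1 : σ ≤ 1 / 4) :
    (randomGraphHalf n).real {G | (O (A.transcript G i)).card = k ∧
        ((pairsIn (O (A.transcript G i)) ∩ (A.transcript G i).probed).card : ℝ) ≤ σ * k ^ 2 ∧
        G.IsClique (O (A.transcript G i) : Set (Fin n))}
      ≤ 2 ^ (-(σ₀ / 2) * k ^ 2 + 3 * k : ℝ) := by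
  classical
  let F : Transcript n → Finset (Finset (Fin n)) := fun t =>
    ({O t} : Finset (Finset (Fin n))).filter fun U =>
      U.card = k ∧ ((pairsIn U ∩ t.probed).card : ℝ) ≤ σ * k ^ 2
  have hM : ∀ G, ((F (A.transcript G i)).card : ℝ) ≤ 1 := by
    intro G
    exact_mod_cast (Finset.card_filter_le _ _).trans (Finset.card_singleton _).le
  have hr : ∀ t, ∀ U ∈ F t,
      (k * (k - 1) / 2 - σ * k ^ 2 : ℝ) ≤ ((pairsIn U \ t.probed).card : ℝ) := by
    intro t U hU
    simp only [F, Finset.mem_filter] at hU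
    have h1 := Finset.card_sdiff_add_card_inter (pairsIn U) t.probed
    rw [card_pairsIn, hU.2.1] at h1
    have h2 : ((pairsIn U \ t.probed).card : ℝ) + ((pairsIn U ∩ t.probed).card : ℝ)
        = k * (k - 1) / 2 := by
      rw [← Nat.cast_choose_two, ← h1]; push_cast; ring
    linarith [hU.2.2]
  refine le_trans (measureReal_mono ?_ (measure_ne_top _ _))
    ((A.measureReal_exists_isClique_le i F _ _ hM hr).trans ?_)
  · rintro G ⟨h1, h2, hG⟩
    exact ⟨_, Finset.mem_filter.2 ⟨Finset.mem_singleton_self _, h1, h2⟩, hG⟩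
  · rw [one_mul]
    refine Real.rpow_le_rpow_of_exponent_le one_le_two ?_
    have hk : (0 : ℝ) ≤ k := Nat.cast_nonneg _
    nlinarith [mul_nonneg (sub_nonneg.2 hσ₀1) (sq_nonneg (k : ℝ)),
      mul_nonneg (sub_nonneg.2 hσ1) (sq_nonneg (k : ℝ))]

lemma card_query_le_probeCount {ℓ i : ℕ} (hi : i < ℓ) (G : SimpleGraph (Fin n)) :
    (A.query (A.transcript G i)).card ≤ A.probeCount ℓ G :=
  Finset.single_le_sum (f := fun i => (A.query (A.transcript G i)).card)
    (fun _ _ => Nat.zero_le _) (Finset.mem_range.2 hi)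

/-- The scale sequence `σ₀ * (1 + 8 / (2 - δ)) ^ i` grows so fast that a clique whose pairs are
mostly probed in the end must, in some round, have far more pairs probed than in all previous
rounds together. -/
lemma measureReal_findsClique_le {ℓ k : ℕ} {δ σ₀ s : ℝ} (hn : 0 < n) (hδ0 : 0 ≤ δ) (hδ2 : δ < 2)
    (hσ₀ : 0 < σ₀) (hσ₀ℓ : σ₀ * (1 + 8 / (2 - δ)) ^ ℓ ≤ 1 / 4)
    (hs : (k : ℝ) < s + 1) (hk : Real.logb 2 n ≤ k * (1 + σ₀) / 2)
    (hA : ∀ G, (A.probeCount ℓ G : ℝ) ≤ (n : ℝ) ^ δ) :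
    (randomGraphHalf n).real {G | A.FindsClique ℓ s G}
      ≤ (ℓ + 1) * 2 ^ (-(σ₀ / 2) * k ^ 2 + 3 * k : ℝ) := by
  classical
  set B : ℝ := 1 + 8 / (2 - δ) with hB
  have hγ : 0 < 2 - δ := by linarith
  have hB1 : 1 ≤ B := by rw [hB]; linarith [div_pos (by norm_num : (0 : ℝ) < 8) hγ]
  let σ : ℕ → ℝ := fun i => σ₀ * B ^ i
  have hσle : ∀ i, σ₀ ≤ σ i := fun i => le_mul_of_one_le_right hσ₀.le (one_le_pow₀ hB1)
  have hσmono : ∀ i ≤ ℓ, σ i ≤ 1 / 4 := fun i hi =>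
    le_trans (mul_le_mul_of_nonneg_left (pow_le_pow_right₀ hB1 hi) hσ₀.le) hσ₀ℓ
  have hσsucc : ∀ i, σ (i + 1) = σ i + 8 / (2 - δ) * σ i := fun i => by
    simp only [σ, pow_succ]; rw [hB]; ring
  have hσ₀1 : σ₀ ≤ 1 / 4 := (hσle ℓ).trans (hσmono ℓ le_rfl)
  -- the part of the output to look at: a subset of size exactly `k`
  have hO : ∀ t : Transcript n, ∃ U ⊆ A.output t, k ≤ (A.output t).card → U.card = k := by
    intro t
    by_cases h : k ≤ (A.output t).card
    · obtain ⟨U, hU, hc⟩ := Finset.exists_subset_card_eq h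
      exact ⟨U, hU, fun _ => hc⟩
    · exact ⟨_, subset_rfl, fun h' => absurd h' h⟩
  choose O hOsub hOcard using hO
  let R : ℕ → Set (SimpleGraph (Fin n)) := fun i => {G | ∃ U : Finset (Fin n), U.card = k ∧
        ((pairsIn U ∩ (A.transcript G i).probed).card : ℝ) ≤ σ i * k ^ 2 ∧
        8 / (2 - δ) * σ i * k ^ 2 ≤ ((pairsIn U ∩ A.query (A.transcript G i)).card : ℝ) ∧
        G.IsClique (U : Set (Fin n))}
  let Z : Set (SimpleGraph (Fin n)) := {G | (O (A.transcript G ℓ)).card = k ∧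
        ((pairsIn (O (A.transcript G ℓ)) ∩ (A.transcript G ℓ).probed).card : ℝ) ≤ σ ℓ * k ^ 2 ∧
        G.IsClique (O (A.transcript G ℓ) : Set (Fin n))}
  have hsub : {G | A.FindsClique ℓ s G} ⊆ (⋃ i ∈ Finset.range ℓ, R i) ∪ Z := by
    rintro G ⟨hG, hcard⟩
    have hk' : k ≤ (A.output (A.transcript G ℓ)).card := by
      have : (k : ℝ) < ((A.output (A.transcript G ℓ)).card + 1 : ℕ) := by push_cast; linarith
      exact Nat.lt_succ_iff.1 (by exact_mod_cast this)
    set U := O (A.transcript G ℓ) with hU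
    have hUk : U.card = k := hOcard _ hk'
    have hUG : G.IsClique (U : Set (Fin n)) := hG.subset (by exact_mod_cast hOsub _)
    by_contra hnot
    simp only [Set.mem_union, Set.mem_iUnion, not_or, not_exists] at hnot
    obtain ⟨hR, hZ⟩ := hnot
    -- outside the exceptional events, the number of probed pairs stays below the scale sequence
    have hfew : ∀ i ≤ ℓ, ((pairsIn U ∩ (A.transcript G i).probed).card : ℝ) ≤ σ i * k ^ 2 := by
      intro i
      induction i with
      | zero =>
        intro _
        have : (A.transcript G 0).probed = ∅ := by
          ext e; simp [transcript, Transcript.probed]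
        rw [this, Finset.inter_empty, Finset.card_empty, Nat.cast_zero]
        have := hσ₀.le.trans (hσle 0)
        positivity
      | succ i ih =>
        intro hi
        have h1 := ih (by omega)
        have h2 : ((pairsIn U ∩ A.query (A.transcript G i)).card : ℝ)
            < 8 / (2 - δ) * σ i * k ^ 2 := by
          by_contra h
          exact hR i (Finset.mem_range.2 (by omega)) ⟨U, hUk, h1, not_lt.1 h, hUG⟩
        rw [probed_transcript_succ, Finset.inter_union_distrib_left, hσsucc]
        have h3 : ((pairsIn U ∩ (A.transcript G i).probed ∪
            pairsIn U ∩ A.query (A.transcript G i)).card : ℝ)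
            ≤ (pairsIn U ∩ (A.transcript G i).probed).card
              + (pairsIn U ∩ A.query (A.transcript G i)).card := by
          exact_mod_cast Finset.card_union_le _ _
        linarith
    exact hZ ⟨hUk, hfew ℓ le_rfl, hUG⟩
  calc _ ≤ _ := measureReal_mono hsub (measure_ne_top _ _)
    _ ≤ _ := measureReal_union_le _ _
    _ ≤ ∑ i ∈ Finset.range ℓ, (2 : ℝ) ^ (-(σ₀ / 2) * k ^ 2 + 3 * k : ℝ)
        + 2 ^ (-(σ₀ / 2) * k ^ 2 + 3 * k : ℝ) := by
      refine add_le_add ((measureReal_biUnion_finset_le _ _).trans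
        (Finset.sum_le_sum fun i hi => ?_))
        (A.measureReal_isClique_of_few_probed_le ℓ O hσ₀1 (hσmono ℓ le_rfl))
      have hi' := Finset.mem_range.1 hi
      refine A.measureReal_exists_isClique_round_le i hn hδ0 hδ2 hσ₀ hσ₀1 (hσle i) ?_ hk
        fun G => le_trans (Nat.cast_le.2 (A.card_query_le_probeCount hi' G)) (hA G)
      have := hσmono (i + 1) hi'
      rw [hσsucc] at this
      linarith [hσle i]
    _ = _ := by
      rw [Finset.sum_const, Finset.card_range, nsmul_eq_mul]; ring

end ProbeAlgorithm

/-! ### Randomized algorithms and the limit of many vertices -/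

/-- A randomized algorithm is no better than the best deterministic algorithm in its support. -/
lemma RandomizedProbeAlgorithm.successProb_le {n : ℕ} (R : RandomizedProbeAlgorithm n) (ℓ : ℕ)
    (s : ℝ) (c : ENNReal)
    (h : ∀ A ∈ R.support, randomGraphHalf n {G | A.FindsClique ℓ s G} ≤ c) :
    R.successProb ℓ s ≤ c := by
  calc R.successProb ℓ s ≤ ∑' A : ProbeAlgorithm n, R A * c := by
        refine ENNReal.tsum_le_tsum fun A => ?_
        by_cases hA : R A = 0
        · simp [hA]
        · exact mul_le_mul_right (h A ((PMF.mem_support_iff _ _).2 hA)) _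
    _ = c := by rw [ENNReal.tsum_mul_right, R.tsum_coe, one_mul]

lemma succ_mul_two_rpow_lt_half {ℓ : ℕ} {σ₀ k : ℝ} (hk1 : 1 ≤ k) (hk : ℓ + 5 ≤ σ₀ / 2 * k) :
    (ℓ + 1) * (2 : ℝ) ^ (-(σ₀ / 2) * k ^ 2 + 3 * k : ℝ) < 1 / 2 := by
  have h1 : -(σ₀ / 2) * k ^ 2 + 3 * k ≤ -((ℓ + 2 : ℕ) : ℝ) := by
    push_cast
    have hl : (0 : ℝ) ≤ ℓ := Nat.cast_nonneg _
    nlinarith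
  have h2 : (2 : ℝ) ^ (-(σ₀ / 2) * k ^ 2 + 3 * k : ℝ) ≤ ((2 : ℝ) ^ (ℓ + 2))⁻¹ := by
    rw [← Real.rpow_natCast 2 (ℓ + 2), ← Real.rpow_neg two_pos.le]
    exact Real.rpow_le_rpow_of_exponent_le one_le_two h1
  have h3 : ((ℓ : ℝ) + 1) < 2 ^ (ℓ + 1) := by exact_mod_cast Nat.lt_two_pow_self (n := ℓ + 1)
  calc _ ≤ ((ℓ : ℝ) + 1) * ((2 : ℝ) ^ (ℓ + 2))⁻¹ :=
        mul_le_mul_of_nonneg_left h2 (by positivity)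
    _ < 2 ^ (ℓ + 1) * ((2 : ℝ) ^ (ℓ + 2))⁻¹ := mul_lt_mul_of_pos_right h3 (by positivity)
    _ = 1 / 2 := by rw [pow_succ _ (ℓ + 1)]; field_simp

/-- For `0 ≤ δ`, the ratio `2 / (1 + σ₀)` is out of reach as soon as the scale sequence that starts
at `σ₀` stays below `1 / 4` for `ℓ` rounds. -/
lemma eventually_successProb_lt_half (ℓ : ℕ) {δ σ₀ : ℝ} (hδ0 : 0 ≤ δ) (hδ2 : δ < 2)
    (hσ₀ : 0 < σ₀) (hσ₀ℓ : σ₀ * (1 + 8 / (2 - δ)) ^ ℓ ≤ 1 / 4) :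
    ∀ᶠ n : ℕ in atTop, ∀ R : RandomizedProbeAlgorithm n, R.ProbesAtMost ℓ ((n : ℝ) ^ δ) →
      ∀ s : ℝ, 2 / (1 + σ₀) * Real.logb 2 n ≤ s → R.successProb ℓ s < 1 / 2 := by
  have hlog : Tendsto (fun n : ℕ => 2 / (1 + σ₀) * Real.logb 2 n) atTop atTop :=
    ((Real.tendsto_logb_atTop one_lt_two).comp tendsto_natCast_atTop_atTop).const_mul_atTop
      (by positivity)
  filter_upwards [hlog.eventually_ge_atTop 1, hlog.eventually_ge_atTop (2 / σ₀ * (ℓ + 5)),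
    eventually_gt_atTop 0] with n h1 h2 hn R hR s hs
  set k : ℕ := ⌈2 / (1 + σ₀) * Real.logb 2 n⌉₊
  have hkle : 2 / (1 + σ₀) * Real.logb 2 n ≤ k := Nat.le_ceil _
  have hklt : (k : ℝ) < s + 1 := (Nat.ceil_lt_add_one (zero_le_one.trans h1)).trans_le (by linarith)
  have hk : Real.logb 2 n ≤ k * (1 + σ₀) / 2 := by
    have := mul_le_mul_of_nonneg_right hkle (by positivity : 0 ≤ (1 + σ₀) / 2)
    have e : 2 / (1 + σ₀) * Real.logb 2 n * ((1 + σ₀) / 2) = Real.logb 2 n := by field_simp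
    linarith
  have hk5 : (ℓ : ℝ) + 5 ≤ σ₀ / 2 * k := by
    have := mul_le_mul_of_nonneg_left (h2.trans hkle) (by positivity : 0 ≤ σ₀ / 2)
    have e : σ₀ / 2 * (2 / σ₀ * ((ℓ : ℝ) + 5)) = ℓ + 5 := by field_simp
    linarith
  have hlt := succ_mul_two_rpow_lt_half (h1.trans hkle) hk5
  refine lt_of_le_of_lt (R.successProb_le ℓ s
    (ENNReal.ofReal ((ℓ + 1) * 2 ^ (-(σ₀ / 2) * k ^ 2 + 3 * k : ℝ))) fun A hA => ?_) ?_
  · rw [← ofReal_measureReal]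
    exact ENNReal.ofReal_le_ofReal
      (A.measureReal_findsClique_le hn hδ0 hδ2 hσ₀ hσ₀ℓ hklt hk (hR A hA))
  · rw [ENNReal.ofReal_lt_iff_lt_toReal (by positivity) (by simp)]
    simpa using hlt

theorem mainTheorem1 (δ : ℝ) (hδ : δ < 2) (ℓ : ℕ) : alphaStar δ ℓ < 2 := by
  -- for `n ≥ 1`, a larger exponent only allows more probes, so `δ` can be taken nonnegative
  set δ' := max δ 0
  have hδ'2 : δ' < 2 := max_lt hδ two_pos
  have hB : 0 < 1 + 8 / (2 - δ') := by
    have : 0 < 2 - δ' := by linarith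
    positivity
  set σ₀ : ℝ := 1 / 4 / (1 + 8 / (2 - δ')) ^ ℓ
  have hσ₀ : 0 < σ₀ := by positivity
  have hσ₀ℓ : σ₀ * (1 + 8 / (2 - δ')) ^ ℓ ≤ 1 / 4 := (div_mul_cancel₀ _ (by positivity)).le
  have hev := eventually_successProb_lt_half ℓ (le_max_right δ 0) hδ'2 hσ₀ hσ₀ℓ
  have hlt : 2 / (1 + σ₀) < 2 := by
    rw [div_lt_iff₀ (by positivity)]; linarith
  refine lt_of_le_of_lt (iSup₂_le fun α hα => ?_)
    (show ((2 / (1 + σ₀) : ℝ) : EReal) < (2 : ℝ) from EReal.coe_lt_coe_iff.2 hlt)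
  rw [EReal.coe_le_coe_iff]
  by_contra! hcon
  obtain ⟨R, hR, hfreq⟩ := hα
  obtain ⟨n, hsucc, hev, hn⟩ := (hfreq.and_eventually (hev.and (eventually_ge_atTop 1))).exists
  have hn1 : (1 : ℝ) ≤ n := Nat.one_le_cast.2 hn
  refine (hev (R n) (fun A hA G => (hR n A hA G).trans ?_) _ ?_).not_ge hsucc
  · exact Real.rpow_le_rpow_of_exponent_le hn1 (le_max_left _ _)
  · exact mul_le_mul_of_nonneg_right hcon.le (Real.logb_nonneg one_lt_two hn1)
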